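/- Let $\mathcal X,\mathcal Y$ be separable complex Hilbert spaces, $d\in\mathbb N$, and let $\mathbb F_d^+$ be the free monoid of words in $d$ letters. For a Hilbert space $\mathcal V$ let $H^2_{\mathcal V}(\mathbb F_d^+)$ be the Fock space of formal power series $f(z)=\sum_{\alpha}f_\alpha z^\alpha$ in noncommuting indeterminates $z=(z_1,\dots,z_d)$ with $f_\alpha\in\mathcal V$ and $\|f\|^2=\sum_\alpha\|f_\alpha\|^2<\infty$. For a Hilbert space $\mathcal F$ let $\mathcal S_{nc,d}(\mathcal F,\mathcal Y)$ be the set of series $S(z)=\sum_\alpha S_\alpha z^\alpha$ with $S_\alpha\in\mathcal L(\mathcal F,\mathcal Y)$ for which the multiplication operator $M_S:u\mapsto Su$, $(Su)_\alpha=\sum_{\beta\gamma=\alpha}S_\beta u_\gamma$, is a contraction from $H^2_{\mathcal F}(\mathbb F_d^+)$ to $H^2_{\mathcal Y}(\mathbb F_d^+)$; such an $S$ is called strictly inner if $M_S$ is an isometry from $H^2_{\mathcal F}(\mathbb F_d^+)$ into $H^2_{\mathcal Y}(\mathbb F_d^+)$. Let $k_{Sz}(z,\zeta)=\sum_\alpha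 z^\alpha\overline\zeta^{\alpha^\top}$ be the noncommutative Szegő kernel, where $\alpha^\top$ is the reversal of $\alpha$ and $\overline\zeta=(\overline\zeta_1,\dots,\overline\zeta_d)$ is a second tuple of noncommuting indeterminates, each commuting with each $z_j$; for a series $S$ put $S(\zeta)^*=\sum_\alpha S_\alpha^*\overline\zeta^{\alpha^\top}$. Let $E\in\mathcal L(\mathcal X,\mathcal Y)$ and $\mathbf T=(T_1,\dots,T_d)\in\mathcal L(\mathcal X)^d$, and write $Z(z)T=z_1T_1+\dots+z_dT_d$, so that $(I-Z(z)T)^{-1}=\sum_\alpha\mathbf T^\alpha z^\alpha$ with $\mathbf T^\alpha$ the product of the $T_j$ along $\alpha$. Suppose that $(E,\mathbf T)$ is output stable, i.e. $\mathcal O:x\mapsto E(I-Z(z)T)^{-1}x=\sum_\alpha(E\mathbf T^\alpha x)z^\alpha$ is a bounded operator from $\mathcal X$ into $H^2_{\mathcal Y}(\mathbb F_d^+)$, and exactly observable, i.e. $P=\mathcal O^*\mathcal O$ is strictly positive definite (positive semidefinite and boundedly invertible). Then there exist a separable Hilbert space $\mathcal F$ and a strictly inner $\Phi\in\mathcal S_{nc,d}(\mathcal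 F,\mathcal Y)$ such that $$k_{Sz}(z,\zeta)I_{\mathcal Y}-\Phi(z)\bigl(k_{Sz}(z,\zeta)I_{\mathcal F}\bigr)\Phi(\zeta)^*=E(I-Z(z)T)^{-1}P^{-1}(I-T^*Z(\zeta)^*)^{-1}E^*$$ as formal power series in $z,\overline\zeta$, where $(I-T^*Z(\zeta)^*)^{-1}E^*=\bigl(E(I-Z(\zeta)T)^{-1}\bigr)^*$. Moreover, for every $\mathbf x\in\mathcal X$, a series $f\in H^2_{\mathcal Y}(\mathbb F_d^+)$ satisfies $\mathcal O^*f=\mathbf x$ if and only if $$f(z)=E(I-Z(z)T)^{-1}P^{-1}\mathbf x+\Phi(z)\sigma(z)\quad\text{for some }\sigma\in H^2_{\mathcal F}(\mathbb F_d^+),$$ and for every $f$ of this form $$\|f\|^2_{H^2_{\mathcal Y}(\mathbb F_d^+)}=\|P^{-1/2}\mathbf x\|^2_{\mathcal X}+\|\sigma\|^2_{H^2_{\mathcal F}(\mathbb F_d^+)}.$$ -/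

import Mathlib

noncomputable section

namespace NCFock

open ContinuousLinearMap

/-- Words in the letters `0, …, d - 1`; multiplication is concatenation and `1` is the empty
word. -/
abbrev Word (d : ℕ) : Type := FreeMonoid (Fin d)

instance instDecidableEqWord (d : ℕ) : DecidableEq (Word d) :=
  inferInstanceAs (DecidableEq (List (Fin d)))

/-- The (finite) set of all factorizations `α = β * γ` of a word, as pairs `(β, γ)`. -/
def factorizations {d : ℕ} (α : Word d) : Finset (Word d × Word d) :=
  (Finset.range (α.toList.length + 1)).image fun k =>
    (FreeMonoid.ofList (α.toList.take k), FreeMonoid.ofList (α.toList.drop k))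

theorem mem_factorizations {d : ℕ} (α : Word d) (p : Word d × Word d) :
    p ∈ factorizations α ↔ p.1 * p.2 = α := by
  simp only [factorizations, Finset.mem_image, Finset.mem_range]
  constructor
  · rintro ⟨k, -, rfl⟩
    exact List.take_append_drop k _
  · rintro rfl
    refine ⟨p.1.toList.length, ?_, ?_⟩
    · simp only [FreeMonoid.toList_mul, List.length_append]
      omega
    · simp only [FreeMonoid.toList_mul, List.take_left', List.drop_left', FreeMonoid.ofList_toList]

/-- A formal power series `∑ f_α z^α` in `d` noncommuting indeterminates with coefficients in
`V`, given by its coefficients. -/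
abbrev Series (d : ℕ) (V : Type*) : Type _ := Word d → V

/-- The Fock space of all series with coefficients in `Y` and `∑ ‖f_α‖ ^ 2 < ∞`. -/
abbrev Fock (d : ℕ) (Y : Type*) [NormedAddCommGroup Y] : Type _ :=
  lp (fun _ : Word d => Y) 2

section Products

variable {d : ℕ} {U V W : Type*}
  [NormedAddCommGroup U] [InnerProductSpace ℂ U]
  [NormedAddCommGroup V] [InnerProductSpace ℂ V]
  [NormedAddCommGroup W] [InnerProductSpace ℂ W]

/-- The product `S(z) u(z)` of an operator-valued and a vector-valued series. -/
def mulVec (S : Series d (U →L[ℂ] V)) (u : Series d U) : Series d V :=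
  fun α => ∑ p ∈ factorizations α, S p.1 (u p.2)

/-- The product `A(z) B(z)` of two operator-valued series. -/
def mulOp (A : Series d (V →L[ℂ] W)) (B : Series d (U →L[ℂ] V)) : Series d (U →L[ℂ] W) :=
  fun α => ∑ p ∈ factorizations α, (A p.1).comp (B p.2)

/-- The constant series `I`. -/
def constId (d : ℕ) (U : Type*) [NormedAddCommGroup U] [InnerProductSpace ℂ U] :
    Series d (U →L[ℂ] U) :=
  fun α => if α = 1 then ContinuousLinearMap.id ℂ U else 0

/-- The Schur class: the operator-valued series `S` such that multiplication by `S` is a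
contraction between the Fock spaces. -/
def SchurClass (d : ℕ) (U V : Type*)
    [NormedAddCommGroup U] [InnerProductSpace ℂ U]
    [NormedAddCommGroup V] [InnerProductSpace ℂ V] : Set (Series d (U →L[ℂ] V)) :=
  {S | ∃ M : Fock d U →L[ℂ] Fock d V, (∀ u : Fock d U, ⇑(M u) = mulVec S u) ∧ ‖M‖ ≤ 1}

/-- `S` is strictly inner: multiplication by `S` is an isometry of the Fock space with
coefficients in `U` into the Fock space with coefficients in `V`. -/
def IsStrictlyInner (S : Series d (U →L[ℂ] V)) : Prop :=
  ∃ M : Fock d U →ₗᵢ[ℂ] Fock d V, ∀ u : Fock d U, ⇑(M u) = mulVec S u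

/-- A formal kernel `∑ K_{α,β} z^α ζ̄^{β^⊤}` with coefficients in the bounded operators on `V`,
given by its coefficients. The `z`'s commute with the `ζ̄`'s. -/
abbrev Kernel (d : ℕ) (V : Type*) [NormedAddCommGroup V] [InnerProductSpace ℂ V] : Type _ :=
  Word d → Word d → (V →L[ℂ] V)

/-- The Szegő kernel `∑ z^α ζ̄^{α^⊤} I`. -/
def szego (d : ℕ) (V : Type*) [NormedAddCommGroup V] [InnerProductSpace ℂ V] : Kernel d V :=
  fun α β => if α = β then ContinuousLinearMap.id ℂ V else 0

/-- The formal kernel `S(z) K(z, ζ) S(ζ)^*`. As `S(ζ)^* = ∑ S_β^* ζ̄^{β^⊤}` and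
`ζ̄^{γ^⊤} ζ̄^{β^⊤} = ζ̄^{(βγ)^⊤}`, the coefficient at `(α, α')` is the sum of all
`S_β K_{γ,γ'} S_{β'}^*` with `βγ = α` and `β'γ' = α'`. -/
def conjKernel [CompleteSpace U] [CompleteSpace V]
    (S : Series d (U →L[ℂ] V)) (K : Kernel d U) : Kernel d V :=
  fun α α' => ∑ p ∈ factorizations α, ∑ q ∈ factorizations α',
    ((S p.1).comp (K p.2 q.2)).comp (adjoint (S q.1))

/-- The formal kernel `H(z) Q H(ζ)^*` for a constant operator `Q`. -/
def conjConst [CompleteSpace U] [CompleteSpace V]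
    (H : Series d (U →L[ℂ] V)) (Q : U →L[ℂ] U) : Kernel d V :=
  fun α β => ((H α).comp Q).comp (adjoint (H β))

end Products

section Observability

variable {d : ℕ} {X Y : Type*}
  [NormedAddCommGroup X] [InnerProductSpace ℂ X]
  [NormedAddCommGroup Y] [InnerProductSpace ℂ Y]

/-- The series `Z(z) T = z_1 T_1 + ⋯ + z_d T_d`. -/
def pencil (T : Fin d → X →L[ℂ] X) : Series d (X →L[ℂ] X) :=
  fun α => ∑ j, if α = FreeMonoid.of j then T j else 0

/-- The series `(I - Z(z) T)⁻¹ = ∑ T^α z^α`, where `T^α` is the product of the `T_j` along the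
word `α`. -/
def resolventSeries (T : Fin d → X →L[ℂ] X) : Series d (X →L[ℂ] X) :=
  fun α => FreeMonoid.lift T α

theorem constId_sub_pencil_one (T : Fin d → X →L[ℂ] X) :
    (constId d X - pencil T) 1 = ContinuousLinearMap.id ℂ X := by
  have h : ∀ j : Fin d, (1 : Word d) ≠ FreeMonoid.of j := fun j => (FreeMonoid.of_ne_one j).symm
  simp [constId, pencil, h]

theorem constId_sub_pencil_of (T : Fin d → X →L[ℂ] X) (j : Fin d) :
    (constId d X - pencil T) (FreeMonoid.of j) = -T j := by
  simp [constId, pencil, FreeMonoid.of_injective.eq_iff]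

theorem constId_sub_pencil_eq_zero (T : Fin d → X →L[ℂ] X) {α : Word d} (h1 : α ≠ 1)
    (h2 : ∀ j, α ≠ FreeMonoid.of j) : (constId d X - pencil T) α = 0 := by
  simp [constId, pencil, h1, h2]

theorem mulOp_resolventSeries (T : Fin d → X →L[ℂ] X) :
    mulOp (constId d X - pencil T) (resolventSeries T) = constId d X := by
  funext α
  unfold mulOp
  induction α using FreeMonoid.casesOn with
  | one =>
    have hf : factorizations (1 : Word d) = {(1, 1)} := by
      ext ⟨a, b⟩
      simp [mem_factorizations]
    rw [hf, Finset.sum_singleton, constId_sub_pencil_one]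
    simp [resolventSeries, constId, ContinuousLinearMap.one_def]
  | of_mul j w =>
    have hne : ((1 : Word d), FreeMonoid.of j * w) ≠ (FreeMonoid.of j, w) := fun h =>
      FreeMonoid.of_ne_one j (congrArg Prod.fst h).symm
    have hsub : ({(1, FreeMonoid.of j * w), (FreeMonoid.of j, w)} : Finset (Word d × Word d)) ⊆
        factorizations (FreeMonoid.of j * w) := by
      intro p hp
      simp only [Finset.mem_insert, Finset.mem_singleton] at hp
      rcases hp with rfl | rfl <;> simp [mem_factorizations]
    rw [← Finset.sum_subset hsub, Finset.sum_pair hne, constId_sub_pencil_one,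
      constId_sub_pencil_of]
    · have h1 : FreeMonoid.of j * w ≠ 1 := fun h => List.cons_ne_nil _ _ h
      simp only [resolventSeries, constId, if_neg h1, map_mul, FreeMonoid.lift_eval_of]
      ext x
      simp
    · rintro ⟨a, b⟩ hp hp'
      rw [mem_factorizations] at hp
      rw [constId_sub_pencil_eq_zero, ContinuousLinearMap.zero_comp]
      · rintro rfl
        apply hp'
        simp at hp
        simp [hp]
      · rintro i rfl
        apply hp'
        obtain ⟨rfl, rfl⟩ := List.cons.inj hp
        exact Finset.mem_insert_of_mem (Finset.mem_singleton_self _)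

theorem resolventSeries_mulOp (T : Fin d → X →L[ℂ] X) :
    mulOp (resolventSeries T) (constId d X - pencil T) = constId d X := by
  funext α
  unfold mulOp
  rcases List.eq_nil_or_concat α.toList with h0 | ⟨w, j, h0⟩
  · obtain rfl : α = 1 := h0
    have hf : factorizations (1 : Word d) = {(1, 1)} := by
      ext ⟨a, b⟩
      simp [mem_factorizations]
    rw [hf, Finset.sum_singleton, constId_sub_pencil_one]
    simp [resolventSeries, constId, ContinuousLinearMap.one_def]
  · obtain rfl : α = FreeMonoid.ofList w * FreeMonoid.of j := h0.trans (List.concat_eq_append ..)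
    generalize FreeMonoid.ofList w = w
    have hne : (w * FreeMonoid.of j, (1 : Word d)) ≠ (w, FreeMonoid.of j) := fun h =>
      FreeMonoid.of_ne_one j (congrArg Prod.snd h).symm
    have hsub : ({(w * FreeMonoid.of j, 1), (w, FreeMonoid.of j)} : Finset (Word d × Word d)) ⊆
        factorizations (w * FreeMonoid.of j) := by
      intro p hp
      simp only [Finset.mem_insert, Finset.mem_singleton] at hp
      rcases hp with rfl | rfl <;> simp [mem_factorizations]
    rw [← Finset.sum_subset hsub, Finset.sum_pair hne, constId_sub_pencil_one,
      constId_sub_pencil_of]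
    · have h1 : w * FreeMonoid.of j ≠ 1 := fun h =>
        List.append_ne_nil_of_right_ne_nil _ (List.cons_ne_nil _ _) h
      simp only [resolventSeries, constId, if_neg h1, map_mul, FreeMonoid.lift_eval_of]
      ext x
      simp
    · rintro ⟨a, b⟩ hp hp'
      rw [mem_factorizations] at hp
      rw [constId_sub_pencil_eq_zero, ContinuousLinearMap.comp_zero]
      · rintro rfl
        apply hp'
        simp at hp
        simp [hp]
      · rintro i rfl
        apply hp'
        obtain ⟨rfl, h⟩ := List.append_inj' hp rfl
        obtain rfl := FreeMonoid.of_injective h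
        exact Finset.mem_insert_of_mem (Finset.mem_singleton_self _)

/-- The series `E (I - Z(z) T)⁻¹`. -/
def outputSeries (E : X →L[ℂ] Y) (T : Fin d → X →L[ℂ] X) : Series d (X →L[ℂ] Y) :=
  fun α => E.comp (resolventSeries T α)

/-- `(E, T)` is output stable: `x ↦ E (I - Z(z) T)⁻¹ x` is a bounded operator from `X` into the
Fock space. -/
def OutputStable (E : X →L[ℂ] Y) (T : Fin d → X →L[ℂ] X) : Prop :=
  ∃ O : X →L[ℂ] Fock d Y, ∀ (x : X) (α : Word d), O x α = outputSeries E T α x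

/-- The observability operator of an output stable pair. -/
def obs {E : X →L[ℂ] Y} {T : Fin d → X →L[ℂ] X} (h : OutputStable E T) :
    X →L[ℂ] Fock d Y :=
  h.choose

theorem obs_apply {E : X →L[ℂ] Y} {T : Fin d → X →L[ℂ] X} (h : OutputStable E T)
    (x : X) (α : Word d) : obs h x α = outputSeries E T α x :=
  h.choose_spec x α

variable [CompleteSpace X] [CompleteSpace Y]

/-- The observability gramian `P = O^* O`. -/
def gramian {E : X →L[ℂ] Y} {T : Fin d → X →L[ℂ] X} (h : OutputStable E T) : X →L[ℂ] X :=
  (adjoint (obs h)).comp (obs h)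

/-- The pair is exactly observable: its gramian is strictly positive definite, that is, positive
semidefinite and boundedly invertible. -/
def ExactlyObservable {E : X →L[ℂ] Y} {T : Fin d → X →L[ℂ] X} (h : OutputStable E T) : Prop :=
  (gramian h).IsPositive ∧ IsUnit (gramian h)

/-- The left-tangential evaluation `(E^* f)^{∧L}(T^*) = O^* f`. -/
def leftEval {E : X →L[ℂ] Y} {T : Fin d → X →L[ℂ] X} (h : OutputStable E T)
    (f : Fock d Y) : X :=
  adjoint (obs h) f

end Observability

end NCFock

end

universe u v

noncomputable section

namespace NCFock

open ContinuousLinearMap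

local notation "⟪" x ", " y "⟫" => inner ℂ x y

/-! ### Separability of the Fock space. -/

section Separable

variable {d : ℕ} {Y : Type*} [NormedAddCommGroup Y]

/-! Since `T^(αj) = T^α T_j`, the operator `O` intertwines `T_j` with the backward right shift.
Hence `M = ker O^*` is closed and invariant under the right shifts, and a Beurling–Lax theorem
(`exists_linearIsometry_wanderingSeries`) gives `M = Φ · H²_F` with `M_Φ = V` isometric and `F = M ⊖
∑ M z_j`.

As `P = O^*O` is invertible, `f - O P⁻¹ O^* f` lies in `M` for every `f`, which yields `I = O P⁻¹
O^* + V V^*`. The matrix entries of this identity on monomials are the kernel formula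
(`conjKernel_szego_apply`, `adjoint_obs_monomial`). The same decomposition parametrizes the
solutions of `O^* f = x`. The norm formula is Pythagoras together with `‖O P⁻¹ x‖² = ⟪x, P⁻¹ x⟫`
(`norm_rpow_neg_half_sq`). -/

theorem separableSpace_fock [InnerProductSpace ℂ Y] [TopologicalSpace.SeparableSpace Y] :
    TopologicalSpace.SeparableSpace (Fock d Y) := by
  have : Countable (Word d) := inferInstanceAs (Countable (List (Fin d)))
  rw [← TopologicalSpace.isSeparable_univ_iff]
  have h : TopologicalSpace.IsSeparable
      (⋃ α : Word d, Set.range (fun y : Y => (lp.single 2 α y : Fock d Y))) :=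
    .iUnion fun α => TopologicalSpace.isSeparable_range
      (lp.isometry_single (E := fun _ : Word d => Y) (p := 2) α).continuous
  refine (h.span (R := ℂ)).closure.mono fun f _ => ?_
  refine mem_closure_of_tendsto (lp.hasSum_single (by simp) f) (.of_forall fun s => ?_)
  exact Submodule.sum_mem _ fun α _ =>
    Submodule.subset_span (Set.mem_iUnion.2 ⟨α, f α, rfl⟩)

end Separable

/-! ### Right shifts on the Fock space and their adjoints. -/

section Shift

variable {d : ℕ} {Y : Type*} [NormedAddCommGroup Y] [InnerProductSpace ℂ Y]

/-- The inclusion `y ↦ y z^α` of the coefficient space into the Fock space. -/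
def monomial (α : Word d) : Y →ₗᵢ[ℂ] Fock d Y where
  toLinearMap := (lp.singleContinuousLinearMap ℂ (fun _ : Word d => Y) 2 α).toLinearMap
  norm_map' y := lp.norm_single (E := fun _ : Word d => Y) (p := 2) (by simp) α y

theorem inner_monomial_left (α : Word d) (y : Y) (f : Fock d Y) :
    ⟪monomial α y, f⟫ = ⟪y, f α⟫ :=
  lp.inner_single_left α y f

theorem inner_monomial_right (α : Word d) (y : Y) (f : Fock d Y) :
    ⟪f, monomial α y⟫ = ⟪f α, y⟫ :=
  lp.inner_single_right α y f

theorem monomial_apply (α β : Word d) (y : Y) :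
    monomial α y β = if β = α then y else 0 := by
  change (lp.single 2 α y : Fock d Y) β = _
  rw [lp.single_apply, Pi.single_apply]

/-- Right cancellation makes `β ↦ β * γ` injective; this is what makes the right shift an isometry.
-/
theorem orthogonalFamily_monomial_mul (γ : Word d) :
    OrthogonalFamily ℂ (fun _ : Word d => Y) fun β => monomial (d := d) (Y := Y) (β * γ) := by
  intro α β h y y'
  rw [inner_monomial_left, monomial_apply, if_neg, inner_zero_right]
  exact fun h' => h (mul_right_cancel h')

variable [CompleteSpace Y]

/-- The right shift `f(z) ↦ f(z) z^γ`. -/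
def shift (γ : Word d) : Fock d Y →ₗᵢ[ℂ] Fock d Y :=
  (orthogonalFamily_monomial_mul γ).linearIsometry

theorem hasSum_shift (γ : Word d) (f : Fock d Y) :
    HasSum (fun β => monomial (β * γ) (f β)) (shift γ f) :=
  (orthogonalFamily_monomial_mul γ).hasSum_linearIsometry f

theorem shift_monomial (γ β : Word d) (y : Y) : shift γ (monomial β y) = monomial (β * γ) y :=
  (orthogonalFamily_monomial_mul γ).linearIsometry_apply_single y

omit [CompleteSpace Y] in
theorem hasSum_apply {ι : Type*} {g : ι → Fock d Y} {f : Fock d Y} (h : HasSum g f)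
    (α : Word d) : HasSum (fun i => g i α) (f α) :=
  h.mapL (lp.evalCLM ℂ (fun _ : Word d => Y) 2 α)

theorem shift_apply_mul (γ β : Word d) (f : Fock d Y) : shift γ f (β * γ) = f β := by
  refine ext_inner_left ℂ fun y => ?_
  rw [← inner_monomial_left, ← shift_monomial, LinearIsometry.inner_map_map, inner_monomial_left]

theorem shift_apply_eq_zero {γ α : Word d} (h : ∀ β, β * γ ≠ α) (f : Fock d Y) :
    shift γ f α = 0 := by
  refine (hasSum_apply (hasSum_shift γ f) α).unique ?_
  convert hasSum_zero (α := Y) (β := Word d) using 2 with β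
  rw [monomial_apply, if_neg (h β).symm]

/-- Written as a sum over factorizations so that summing over `γ` produces `mulVec`. -/
theorem shift_apply (γ α : Word d) (f : Fock d Y) :
    shift γ f α = ∑ p ∈ factorizations α, if p.2 = γ then f p.1 else 0 := by
  by_cases h : ∃ β, β * γ = α
  · obtain ⟨β, rfl⟩ := h
    rw [shift_apply_mul, Finset.sum_eq_single (β, γ)]
    · simp
    · rintro ⟨a, b⟩ hp hne
      refine if_neg ?_
      rintro rfl
      rw [mem_factorizations] at hp
      exact hne (Prod.ext (mul_right_cancel hp) rfl)
    · simp [mem_factorizations]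
  · push Not at h
    rw [shift_apply_eq_zero h, Finset.sum_eq_zero]
    rintro ⟨a, b⟩ hp
    refine if_neg ?_
    rintro rfl
    exact h a ((mem_factorizations _ _).1 hp)

/-- The backward right shift, adjoint to `shift γ`. -/
def backShift (γ : Word d) : Fock d Y →L[ℂ] Fock d Y :=
  adjoint (shift γ).toContinuousLinearMap

theorem inner_backShift_left (γ : Word d) (f g : Fock d Y) :
    ⟪backShift γ f, g⟫ = ⟪f, shift γ g⟫ :=
  adjoint_inner_left _ _ _

theorem inner_backShift_right (γ : Word d) (f g : Fock d Y) :
    ⟪g, backShift γ f⟫ = ⟪shift γ g, f⟫ :=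
  adjoint_inner_right _ _ _

theorem backShift_apply (γ β : Word d) (f : Fock d Y) : backShift γ f β = f (β * γ) := by
  refine ext_inner_left ℂ fun y => ?_
  rw [← inner_monomial_left, inner_backShift_right, shift_monomial, inner_monomial_left]

/-- Passing to adjoints reduces the claim to associativity, because the coefficients of `backShift`
are explicit at every word. -/
theorem shift_mul (γ δ : Word d) (f : Fock d Y) : shift (γ * δ) f = shift δ (shift γ f) := by
  refine ext_inner_right ℂ fun g => ?_
  rw [← inner_backShift_right, ← inner_backShift_right, ← inner_backShift_right]
  congr 1
  ext β
  simp only [backShift_apply, mul_assoc]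

theorem shift_one (f : Fock d Y) : shift 1 f = f := by
  ext β
  simpa using shift_apply_mul 1 β f

theorem mul_of_inj {α β : Word d} {i j : Fin d}
    (h : α * FreeMonoid.of i = β * FreeMonoid.of j) : α = β ∧ i = j := by
  obtain ⟨h1, h2⟩ := List.append_inj' h rfl
  exact ⟨h1, FreeMonoid.of_injective h2⟩

/-- A nonempty word has only one last letter, so the two ranges have disjoint supports. -/
theorem inner_shift_of_of_ne {i j : Fin d} (h : i ≠ j) (f g : Fock d Y) :
    ⟪shift (FreeMonoid.of i) f, shift (FreeMonoid.of j) g⟫ = 0 := by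
  rw [← inner_backShift_left]
  have : backShift (FreeMonoid.of j) (shift (FreeMonoid.of i) f) = 0 := by
    ext β
    rw [backShift_apply, shift_apply_eq_zero fun α hα => h (mul_of_inj hα).2]
    rfl
  rw [this, inner_zero_left]

/-- Induction on words by appending letters on the right. -/
theorem word_reverse_induction {p : Word d → Prop} (one : p 1)
    (mul_of : ∀ α j, p α → p (α * FreeMonoid.of j)) (α : Word d) : p α :=
  List.reverseRecOn (motive := p) α one fun α j h => mul_of α j h

end Shift

/-! ### Wandering subspaces and the Beurling–Lax theorem. -/

section Wandering

variable {d : ℕ} {Y : Type*} [NormedAddCommGroup Y] [InnerProductSpace ℂ Y] [CompleteSpace Y]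

/-- The wandering subspace `M ⊖ (M z_1 + ⋯ + M z_d)`. -/
def wandering (M : Submodule ℂ (Fock d Y)) : Submodule ℂ (Fock d Y) :=
  M ⊓ (⨆ j : Fin d, M.map (shift (FreeMonoid.of j)).toLinearMap)ᗮ

variable {M : Submodule ℂ (Fock d Y)}

theorem mem_wandering {f : Fock d Y} :
    f ∈ wandering M ↔ f ∈ M ∧ ∀ j, ∀ g ∈ M, ⟪shift (FreeMonoid.of j) g, f⟫ = 0 := by
  simp only [wandering, ← Submodule.iInf_orthogonal, Submodule.mem_inf, Submodule.mem_iInf,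
    Submodule.mem_orthogonal, Submodule.mem_map, forall_exists_index, and_imp,
    forall_apply_eq_imp_iff₂]
  rfl

theorem isClosed_wandering (hM : IsClosed (M : Set (Fock d Y))) :
    IsClosed (wandering M : Set (Fock d Y)) :=
  hM.inter (Submodule.isClosed_orthogonal _)

variable (hinv : ∀ j, ∀ f ∈ M, shift (FreeMonoid.of j) f ∈ M)

include hinv

theorem shift_mem (γ : Word d) {f : Fock d Y} (hf : f ∈ M) : shift γ f ∈ M := by
  induction γ using word_reverse_induction with
  | one => rwa [shift_one]
  | mul_of γ j ih => rw [shift_mul]; exact hinv j _ ih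

/-- Strip last letters from both words. Equal ones cancel by isometry and distinct ones give
orthogonal ranges; once one word is exhausted, the other shifted vector lies in some `M z_j`, which
is orthogonal to the wandering subspace. -/
theorem inner_shift_wandering {γ δ : Word d} (h : γ ≠ δ) {f g : Fock d Y}
    (hf : f ∈ wandering M) (hg : g ∈ wandering M) : ⟪shift γ f, shift δ g⟫ = 0 := by
  have key : ∀ (γ : Word d) (j : Fin d) {f g : Fock d Y}, f ∈ wandering M → g ∈ wandering M →
      ⟪shift (γ * FreeMonoid.of j) f, g⟫ = 0 := fun γ j f g hf hg => by
    rw [shift_mul]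
    exact (mem_wandering.1 hg).2 j _ (shift_mem hinv γ (mem_wandering.1 hf).1)
  induction γ using word_reverse_induction generalizing δ with
  | one =>
    induction δ using word_reverse_induction with
    | one => exact absurd rfl h
    | mul_of δ j => rw [shift_one, inner_eq_zero_symm, key δ j hg hf]
  | mul_of γ i ih =>
    induction δ using word_reverse_induction with
    | one => rw [shift_one, key γ i hf hg]
    | mul_of δ j =>
      rw [shift_mul, shift_mul]
      by_cases hij : i = j
      · subst hij
        rw [LinearIsometry.inner_map_map]
        exact ih fun h' => h (by rw [h'])
      · exact inner_shift_of_of_ne hij _ _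

theorem orthogonalFamily_wandering :
    OrthogonalFamily ℂ (fun _ : Word d => wandering M)
      fun γ => (shift γ).comp (wandering M).subtypeₗᵢ :=
  fun _ _ h v w => inner_shift_wandering hinv h v.2 w.2

/-- An element of a closed shift invariant subspace that is orthogonal to the wandering subspace
is the sum of its components in the ranges of the shifts by letters. -/
theorem eq_sum_shift_of_orthogonal_wandering [M.HasOrthogonalProjection] {f : Fock d Y}
    (hf : f ∈ M) (horth : ∀ w ∈ wandering M, ⟪f, w⟫ = 0) :
    ∃ g : Fin d → Fock d Y, (∀ j, g j ∈ M) ∧ f = ∑ j, shift (FreeMonoid.of j) (g j) := by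
  refine ⟨fun j => M.starProjection (backShift (FreeMonoid.of j) f),
    fun j => Submodule.starProjection_apply_mem _ _, ?_⟩
  set s := ∑ j, shift (FreeMonoid.of j) (M.starProjection (backShift (FreeMonoid.of j) f))
    with hs
  -- Pairing with `g z_k` leaves only the `k`-th summand of `s`, and `backShift f` minus its
  -- projection onto `M` is orthogonal to `g`.
  have hw : f - s ∈ wandering M := by
    refine mem_wandering.2 ⟨M.sub_mem hf (M.sum_mem fun j _ =>
      hinv j _ (Submodule.starProjection_apply_mem _ _)), fun k g hg => ?_⟩
    rw [inner_sub_right, hs, inner_sum, Finset.sum_eq_single k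
      (fun j _ hj => inner_shift_of_of_ne hj.symm _ _) (by simp), LinearIsometry.inner_map_map,
      ← inner_backShift_right, ← inner_sub_right]
    exact Submodule.sub_starProjection_mem_orthogonal _ g hg
  -- Both `f` and `s` are orthogonal to the wandering subspace, which contains `f - s`.
  have h0 : ⟪f - s, f - s⟫ = 0 := by
    conv_lhs => rw [inner_sub_left]
    rw [horth _ hw, hs, sum_inner, Finset.sum_eq_zero, sub_zero]
    exact fun j _ => (mem_wandering.1 hw).2 j _ (Submodule.starProjection_apply_mem _ _)
  exact sub_eq_zero.1 (inner_self_eq_zero.1 h0)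

/-- Write `f = ∑ g_j z_j` with `g_j ∈ M`. The constant coefficient vanishes, the coefficient at `αk`
is that of `g_k` at `α`, and `g_k` inherits the orthogonality hypothesis, so induction on the word
kills every coefficient. -/
theorem eq_zero_of_orthogonal_shift_wandering [M.HasOrthogonalProjection] {f : Fock d Y}
    (hf : f ∈ M) (horth : ∀ γ, ∀ w ∈ wandering M, ⟪f, shift γ w⟫ = 0) : f = 0 := by
  ext α
  change f α = 0
  induction α using word_reverse_induction generalizing f with
  | one =>
    obtain ⟨g, -, rfl⟩ := eq_sum_shift_of_orthogonal_wandering hinv hf fun w hw => by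
      simpa [shift_one] using horth 1 w hw
    rw [lp.coeFn_sum, Finset.sum_apply]
    exact Finset.sum_eq_zero fun j _ => shift_apply_eq_zero (fun β h =>
      List.append_ne_nil_of_right_ne_nil _ (List.cons_ne_nil _ _) h) _
  | mul_of α k ih =>
    obtain ⟨g, hg, rfl⟩ := eq_sum_shift_of_orthogonal_wandering hinv hf fun w hw => by
      simpa [shift_one] using horth 1 w hw
    rw [lp.coeFn_sum, Finset.sum_apply, Finset.sum_eq_single k, shift_apply_mul]
    · refine ih (hg k) fun γ w hw => ?_
      rw [← horth (γ * FreeMonoid.of k) w hw, sum_inner, shift_mul, Finset.sum_eq_single k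
        (fun j _ hj => inner_shift_of_of_ne hj _ _) (by simp), LinearIsometry.inner_map_map]
    · exact fun j _ hj => shift_apply_eq_zero (fun β h => hj (mul_of_inj h).2) _
    · simp

omit hinv

/-- The series `∑ Φ_α z^α`, where `Φ_α w` is the coefficient of `w` at `α`. -/
def wanderingSeries (M : Submodule ℂ (Fock d Y)) : Series d (wandering M →L[ℂ] Y) :=
  fun α => (lp.evalCLM ℂ (fun _ : Word d => Y) 2 α).comp (wandering M).subtypeL

/-- A noncommutative Beurling–Lax theorem: a closed subspace of the Fock space that is invariant
under the right shifts is the range of multiplication by a strictly inner series. -/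
theorem exists_linearIsometry_wanderingSeries [M.HasOrthogonalProjection]
    (hinv : ∀ j, ∀ f ∈ M, shift (FreeMonoid.of j) f ∈ M) (hM : IsClosed (M : Set (Fock d Y))) :
    ∃ V : Fock d (wandering M) →ₗᵢ[ℂ] Fock d Y,
      (∀ u, ⇑(V u) = mulVec (wanderingSeries M) u) ∧ LinearMap.range V.toLinearMap = M := by
  have : CompleteSpace (wandering M) := (isClosed_wandering hM).completeSpace_coe
  have hV := orthogonalFamily_wandering hinv
  refine ⟨hV.linearIsometry, fun u => ?_, ?_⟩
  · funext α
    refine (hasSum_apply (hV.hasSum_linearIsometry u) α).unique ?_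
    simp only [LinearIsometry.coe_comp, Function.comp_apply, shift_apply]
    refine hasSum_sum fun p _ => ?_
    convert hasSum_ite_eq p.2 (wanderingSeries M p.1 (u p.2)) using 2 with γ
    by_cases h : p.2 = γ
    · subst h; simp; rfl
    · rw [if_neg h, if_neg (Ne.symm h)]
  · have hle : LinearMap.range hV.linearIsometry.toLinearMap ≤ M := by
      rw [hV.range_linearIsometry]
      refine Submodule.topologicalClosure_minimal _ (iSup_le fun γ => ?_) hM
      rintro _ ⟨w, rfl⟩
      exact shift_mem hinv γ (mem_wandering.1 w.2).1
    refine le_antisymm hle fun f hf => ?_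
    have hcl : IsClosed (LinearMap.range hV.linearIsometry.toLinearMap : Set (Fock d Y)) :=
      hV.linearIsometry.isometry.isUniformInducing.isComplete_range.isClosed
    set R := LinearMap.range hV.linearIsometry.toLinearMap
    have : CompleteSpace R := hcl.completeSpace_coe
    -- The residual lies in `M` and is orthogonal to every shifted wandering vector, since these all
    -- lie in `R`.
    have h0 : f - R.starProjection f = 0 := by
      refine eq_zero_of_orthogonal_shift_wandering hinv
        (M.sub_mem hf (hle (Submodule.starProjection_apply_mem _ _))) fun γ w hw => ?_
      rw [inner_eq_zero_symm]
      exact Submodule.sub_starProjection_mem_orthogonal f _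
        ⟨lp.single 2 γ ⟨w, hw⟩, hV.linearIsometry_apply_single _⟩
    rw [sub_eq_zero.1 h0]
    exact Submodule.starProjection_apply_mem _ _

end Wandering

/-! ### Multiplication operators and their kernels. -/

section Multiplication

variable {d : ℕ} {U Y : Type*} [NormedAddCommGroup U] [InnerProductSpace ℂ U] [CompleteSpace U]
  [NormedAddCommGroup Y] [InnerProductSpace ℂ Y] [CompleteSpace Y]

/-- The coefficients of `M_S^* (y z^β)`. -/
theorem adjoint_mulVec_monomial {S : Series d (U →L[ℂ] Y)} {M : Fock d U →L[ℂ] Fock d Y}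
    (hM : ∀ u : Fock d U, ⇑(M u) = mulVec S u) (β γ : Word d) (y : Y) :
    adjoint M (monomial β y) γ =
      ∑ q ∈ factorizations β, if γ = q.2 then adjoint (S q.1) y else 0 := by
  refine ext_inner_left ℂ fun u => ?_
  rw [← inner_monomial_left, adjoint_inner_right, inner_monomial_right, hM, mulVec, sum_inner,
    inner_sum]
  refine Finset.sum_congr rfl fun q _ => ?_
  rw [monomial_apply]
  by_cases h : γ = q.2
  · rw [if_pos h, if_pos h.symm, adjoint_inner_right]
  · rw [if_neg h, if_neg (Ne.symm h), map_zero, inner_zero_left, inner_zero_right]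

/-- The coefficients of `S(z) k_Sz(z, ζ) S(ζ)^*` are the matrix entries of `M_S M_S^*`. -/
theorem conjKernel_szego_apply {S : Series d (U →L[ℂ] Y)} {M : Fock d U →L[ℂ] Fock d Y}
    (hM : ∀ u : Fock d U, ⇑(M u) = mulVec S u) (α β : Word d) (y : Y) :
    conjKernel S (szego d U) α β y = M (adjoint M (monomial β y)) α := by
  rw [hM, mulVec, conjKernel, sum_apply]
  refine Finset.sum_congr rfl fun p _ => ?_
  rw [adjoint_mulVec_monomial hM, map_sum, sum_apply]
  refine Finset.sum_congr rfl fun q _ => ?_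
  simp only [szego, comp_apply]
  split_ifs <;> simp

end Multiplication

/-! ### Intertwining and the gramian. -/

section Observability

variable {d : ℕ} {X Y : Type*}
  [NormedAddCommGroup X] [InnerProductSpace ℂ X] [CompleteSpace X]
  [NormedAddCommGroup Y] [InnerProductSpace ℂ Y] [CompleteSpace Y]
  {E : X →L[ℂ] Y} {T : Fin d → X →L[ℂ] X} (hs : OutputStable E T)

omit [CompleteSpace X] in
theorem backShift_obs (j : Fin d) (x : X) :
    backShift (FreeMonoid.of j) (obs hs x) = obs hs (T j x) := by
  ext α
  rw [backShift_apply, obs_apply, obs_apply, outputSeries, outputSeries, resolventSeries, map_mul,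
    FreeMonoid.lift_eval_of]
  rfl

/-- Adjoint form of `backShift_obs`: `O^* (f z_j) = T_j^* O^* f`. -/
theorem shift_mem_ker_adjoint_obs (j : Fin d) {f : Fock d Y}
    (hf : f ∈ (adjoint (obs hs)).ker) :
    shift (FreeMonoid.of j) f ∈ (adjoint (obs hs)).ker := by
  rw [LinearMap.mem_ker] at hf ⊢
  refine ext_inner_right ℂ fun x => ?_
  erw [adjoint_inner_left, ← inner_backShift_right, backShift_obs, ← adjoint_inner_left, hf]
  simp

theorem adjoint_obs_monomial (β : Word d) (y : Y) :
    adjoint (obs hs) (monomial β y) = adjoint (outputSeries E T β) y := by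
  refine ext_inner_right ℂ fun x => ?_
  rw [adjoint_inner_left, adjoint_inner_left, inner_monomial_left, obs_apply]

variable {hs}

theorem ExactlyObservable.adjoint_obs_obs_inverse (ho : ExactlyObservable hs) (x : X) :
    adjoint (obs hs) (obs hs (Ring.inverse (gramian hs) x)) = x :=
  congrArg (fun A : X →L[ℂ] X => A x) (Ring.mul_inverse_cancel _ ho.2)

/-- Both sides equal `⟪x, P⁻¹ x⟫`: `P^(-1/2)` is self-adjoint with square `P⁻¹`, and `O^* O P⁻¹ =
I`. -/
theorem ExactlyObservable.norm_rpow_neg_half_sq (ho : ExactlyObservable hs) (x : X) :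
    ‖(gramian hs ^ (-(1 / 2) : ℝ)) x‖ ^ 2 = ‖obs hs (Ring.inverse (gramian hs) x)‖ ^ 2 := by
  have h0 : 0 ≤ gramian hs := (nonneg_iff_isPositive _).2 ho.1
  have hsp : IsStrictlyPositive (gramian hs) := ho.2.isStrictlyPositive h0
  have hsa : adjoint (gramian hs ^ (-(1 / 2) : ℝ)) = gramian hs ^ (-(1 / 2) : ℝ) :=
    (IsSelfAdjoint.of_nonneg CFC.rpow_nonneg).adjoint_eq
  have hmul : gramian hs ^ (-(1 / 2) : ℝ) * gramian hs ^ (-(1 / 2) : ℝ) =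
      Ring.inverse (gramian hs) := by
    rw [← CFC.rpow_add ho.2, CFC.inverse_eq_rpow_neg_one hsp]
    norm_num
  have h1 : ⟪(gramian hs ^ (-(1 / 2) : ℝ)) x, (gramian hs ^ (-(1 / 2) : ℝ)) x⟫ =
      ⟪obs hs (Ring.inverse (gramian hs) x), obs hs (Ring.inverse (gramian hs) x)⟫ := by
    have hx := adjoint_inner_right (gramian hs ^ (-(1 / 2) : ℝ)) x
      ((gramian hs ^ (-(1 / 2) : ℝ)) x)
    rw [hsa] at hx
    rw [← hx, ← adjoint_inner_left (obs hs), ho.adjoint_obs_obs_inverse, ← hmul]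
    rfl
  rw [inner_self_eq_norm_sq_to_K, inner_self_eq_norm_sq_to_K] at h1
  exact_mod_cast h1

end Observability

end NCFock

end

/-! ### The kernel identity and the parametrization of solutions. -/

theorem theoremT {d : ℕ} {X : Type u} {Y : Type v}
    [NormedAddCommGroup X] [InnerProductSpace ℂ X] [CompleteSpace X]
    [TopologicalSpace.SeparableSpace X]
    [NormedAddCommGroup Y] [InnerProductSpace ℂ Y] [CompleteSpace Y]
    [TopologicalSpace.SeparableSpace Y]
    (E : X →L[ℂ] Y) (T : Fin d → X →L[ℂ] X)
    (hs : NCFock.OutputStable E T) (ho : NCFock.ExactlyObservable hs) :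
    ∃ (F : Type v) (_ : NormedAddCommGroup F) (_ : InnerProductSpace ℂ F)
      (_ : CompleteSpace F) (_ : TopologicalSpace.SeparableSpace F)
      (Φ : NCFock.Series d (F →L[ℂ] Y)),
      Φ ∈ NCFock.SchurClass d F Y ∧
      NCFock.IsStrictlyInner Φ ∧
      NCFock.szego d Y - NCFock.conjKernel Φ (NCFock.szego d F) =
        NCFock.conjConst (NCFock.outputSeries E T) (Ring.inverse (NCFock.gramian hs)) ∧
      ∀ x : X,
        (∀ f : NCFock.Fock d Y,
          NCFock.leftEval hs f = x ↔
            ∃ σ : NCFock.Fock d F, ∀ α : NCFock.Word d,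
              f α = NCFock.outputSeries E T α (Ring.inverse (NCFock.gramian hs) x) +
                NCFock.mulVec Φ σ α) ∧
        (∀ (f : NCFock.Fock d Y) (σ : NCFock.Fock d F),
          (∀ α : NCFock.Word d,
            f α = NCFock.outputSeries E T α (Ring.inverse (NCFock.gramian hs) x) +
              NCFock.mulVec Φ σ α) →
          ‖f‖ ^ 2 = ‖(NCFock.gramian hs ^ (-(1 / 2) : ℝ)) x‖ ^ 2 + ‖σ‖ ^ 2) := by
  have hcl : IsClosed ((ContinuousLinearMap.adjoint (NCFock.obs hs)).ker :
      Set (NCFock.Fock d Y)) :=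
    (ContinuousLinearMap.adjoint (NCFock.obs hs)).isClosed_ker
  set M := (ContinuousLinearMap.adjoint (NCFock.obs hs)).ker with hMdef
  have : CompleteSpace M := hcl.completeSpace_coe
  have hc : CompleteSpace (NCFock.wandering M) :=
    (NCFock.isClosed_wandering hcl).completeSpace_coe
  have := NCFock.separableSpace_fock (d := d) (Y := Y)
  obtain ⟨V, hV, hVM⟩ := NCFock.exists_linearIsometry_wanderingSeries (M := M)
    (fun j f hf => NCFock.shift_mem_ker_adjoint_obs hs j hf) hcl
  have hOV : ∀ u, ContinuousLinearMap.adjoint (NCFock.obs hs) (V u) = 0 := fun u =>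
    LinearMap.mem_ker.1 (hVM.le ⟨u, rfl⟩ : V u ∈ M)
  have hVO : ∀ x, ContinuousLinearMap.adjoint V.toContinuousLinearMap (NCFock.obs hs x) = 0 :=
    fun x => ext_inner_right ℂ fun u => by
      rw [ContinuousLinearMap.adjoint_inner_left, ← ContinuousLinearMap.adjoint_inner_right]
      erw [hOV]
      simp
  have hVV : ∀ u, ContinuousLinearMap.adjoint V.toContinuousLinearMap (V u) = u :=
    fun u => ext_inner_right ℂ fun v => by
      rw [ContinuousLinearMap.adjoint_inner_left]
      exact V.inner_map_map u v
  -- The remainder after `O P⁻¹ O^* f` is killed by `O^*`, hence lies in `M = ran V`.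
  have hdec : ∀ f, ∃ σ, f = NCFock.obs hs (Ring.inverse (NCFock.gramian hs)
      (ContinuousLinearMap.adjoint (NCFock.obs hs) f)) + V σ := fun f => by
    have hmem : f - NCFock.obs hs (Ring.inverse (NCFock.gramian hs)
        (ContinuousLinearMap.adjoint (NCFock.obs hs) f)) ∈ M :=
      LinearMap.mem_ker.2 (by
        change ContinuousLinearMap.adjoint (NCFock.obs hs) _ = 0
        rw [map_sub, ho.adjoint_obs_obs_inverse, sub_self])
    rw [← hVM] at hmem
    obtain ⟨σ, hσ⟩ := hmem
    exact ⟨σ, by rw [show V σ = _ from hσ]; abel⟩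
  have hiff : ∀ (f : NCFock.Fock d Y) (σ : NCFock.Fock d (NCFock.wandering M)) (x : X),
      (∀ α : NCFock.Word d,
        f α = NCFock.outputSeries E T α (Ring.inverse (NCFock.gramian hs) x) +
          NCFock.mulVec (NCFock.wanderingSeries M) σ α) ↔
      f = NCFock.obs hs (Ring.inverse (NCFock.gramian hs) x) + V σ := fun f σ x => by
    rw [← hV, lp.ext_iff, funext_iff]
    simp only [lp.coeFn_add, Pi.add_apply, NCFock.obs_apply]
  refine ⟨NCFock.wandering M, inferInstance, inferInstance, hc,
    (TopologicalSpace.IsSeparable.of_separableSpace _).separableSpace,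
    NCFock.wanderingSeries M,
    ⟨V.toContinuousLinearMap, hV, V.norm_toContinuousLinearMap_le⟩, ⟨V, hV⟩, ?_,
    fun x => ⟨fun f => ⟨fun h => ?_, ?_⟩, fun f σ h => ?_⟩⟩
  · funext α β
    ext y
    obtain ⟨σ, hσ⟩ := hdec (NCFock.monomial β y)
    -- Applying `V^*` identifies `σ` as `V^*` of the monomial, so the `V σ` term is `V V^*`, the
    -- conjugated Szegő kernel.
    have hσ' := congrArg (ContinuousLinearMap.adjoint V.toContinuousLinearMap) hσ
    rw [map_add, hVO, hVV, zero_add] at hσ'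
    have hα : NCFock.monomial β y α = _ := congrArg (fun f : NCFock.Fock d Y => f α) hσ
    rw [lp.coeFn_add, Pi.add_apply, NCFock.obs_apply, NCFock.adjoint_obs_monomial, ← hσ',
      NCFock.monomial_apply] at hα
    simp only [Pi.sub_apply, sub_apply]
    rw [NCFock.conjKernel_szego_apply (M := V.toContinuousLinearMap) hV, sub_eq_iff_eq_add]
    refine Eq.trans ?_ hα
    unfold NCFock.szego
    split_ifs <;> rfl
  · obtain ⟨σ, hσ⟩ := hdec f
    rw [show ContinuousLinearMap.adjoint (NCFock.obs hs) f = x from h] at hσ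
    exact ⟨σ, (hiff f σ x).2 hσ⟩
  · rintro ⟨σ, h⟩
    rw [(hiff f σ x).1 h, NCFock.leftEval, map_add, ho.adjoint_obs_obs_inverse, hOV, add_zero]
  · rw [(hiff f σ x).1 h, ho.norm_rpow_neg_half_sq, ← V.norm_map σ, sq, sq, sq]
    -- The two summands are orthogonal because `ran V = ker O^*`.
    refine norm_add_sq_eq_norm_sq_add_norm_sq_of_inner_eq_zero (𝕜 := ℂ) _ _ ?_
    rw [← ContinuousLinearMap.adjoint_inner_right, hOV, inner_zero_right]
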